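/- Let $F(a,b)$ be the free group with basis $\{a,b\}$, write $g\sim h$ if $g,h\in F(a,b)$ are conjugate in $F(a,b)$, and let $\sigma_a(w),\sigma_b(w)\in\mathbb{Z}$ denote the exponent sums of $a$ and $b$ in $w\in F(a,b)$. Let $\psi:F(a,b)\to F(a,b)$ be an injective, non-surjective endomorphism whose associated matrix $$\Psi_{(a,b)}=\begin{pmatrix}\sigma_a(\psi(a))&\sigma_b(\psi(a))\\ \sigma_a(\psi(b))&\sigma_b(\psi(b))\end{pmatrix}$$ satisfies $\det(\Psi_{(a,b)})=\pm1$. Suppose that $\psi$ has a non-trivial maximal outer fixed point, that is, a conjugacy class $\alpha\neq\{1\}$ of an element $x\in F(a,b)$ such that $\psi(x)\sim x$ and $x$ is not a proper power ($x\neq x_0^n$ for all $x_0\in F(a,b)$ and all integers $n>1$). If $\psi^p(w)\sim w^q$ for some $w\in F(a,b)\setminus\{1\}$ and some $p,q\in\mathbb{Z}\setminus\{0\}$, then $q=\pm1$. Here, for $p<0$, $\psi^p(w)$ denotes the unique element $u$ with $\psi^{-p}(u)=w$, and the hypothesis $\psi^p(w)\sim w^q$ includes that such a $u$ exists. -/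

import Mathlib

/-- The free group `F(a, b)` of rank two; its fixed basis is `a = of 0`, `b = of 1`. -/
abbrev FreeGroupAB : Type := FreeGroup (Fin 2)

namespace FreeGroupAB

/-- The exponent sum `σ_i(w)` of the `i`-th basis letter in `w`, as a homomorphism to `ℤ`
(written multiplicatively) that sends the `i`-th letter to `1` and the other letter to `0`. -/
def exponentSum (i : Fin 2) (w : FreeGroupAB) : ℤ :=
  Multiplicative.toAdd
    (FreeGroup.lift (fun j : Fin 2 => Multiplicative.ofAdd (if j = i then (1 : ℤ) else 0)) w)

/-- The matrix associated with an endomorphism: its rows are the exponent-sum vectors of the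
images of `a` and of `b`. -/
def associatedMatrix (ψ : FreeGroupAB →* FreeGroupAB) : Matrix (Fin 2) (Fin 2) ℤ :=
  Matrix.of fun i j => exponentSum j (ψ (FreeGroup.of i))

/-- `w` is a proper power: `w = w₀ ^ p` for some `w₀` and some integer `p > 1`. -/
def IsProperPower (w : FreeGroupAB) : Prop :=
  ∃ (w₀ : FreeGroupAB) (p : ℤ), 1 < p ∧ w = w₀ ^ p

/-- An outer fixed element of `ψ`: an element that `ψ` maps to a conjugate of itself. -/
def IsOuterFixedElement (ψ : FreeGroupAB →* FreeGroupAB) (w : FreeGroupAB) : Prop :=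
  IsConj (ψ w) w

/-- A maximal outer fixed element of `ψ`: an outer fixed element that is not a proper power. -/
def IsMaximalOuterFixedElement (ψ : FreeGroupAB →* FreeGroupAB) (w : FreeGroupAB) : Prop :=
  IsOuterFixedElement ψ w ∧ ¬ IsProperPower w

/-- A maximal outer fixed point of `ψ`: the conjugacy class of a maximal outer fixed element. -/
def IsMaximalOuterFixedPoint (ψ : FreeGroupAB →* FreeGroupAB)
    (α : ConjClasses FreeGroupAB) : Prop :=
  ∃ w : FreeGroupAB, IsMaximalOuterFixedElement ψ w ∧ α = ConjClasses.mk w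

/-- `ZPowRel ψ p w u` says that `ψ ^ p (w)` is defined and equal to `u`, for an integer `p`.
For `p ≥ 0` this is the usual iterate. For `p < 0` it is the partially defined inverse of the
iterate `ψ ^ (-p)`: the element `u` satisfies `ψ ^ (-p) (u) = w` (it is unique when `ψ` is
injective, and exists exactly when `w` lies in the image of `ψ ^ (-p)`). -/
def ZPowRel (ψ : FreeGroupAB →* FreeGroupAB) : ℤ → FreeGroupAB → FreeGroupAB → Prop
  | Int.ofNat n, w, u => ψ^[n] w = u
  | Int.negSucc n, w, u => ψ^[n + 1] u = w

end FreeGroupAB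

/-! If `q ≠ ±1`, some prime `l` divides `q`. Homomorphisms to finite `l`-groups see nontrivial
elements (`exists_isPGroup_apply_ne_one`). For a finite `l`-group `Q`, precomposition with `ψ`
permutes the finite set `Hom(F, Q)`, because an `l`-group is generated modulo its maximal subgroups
and `det = ±1` (`comp_right_bijective`). So the largest order of an image of `w` in `Q` is also the
largest for `ψ^[n] w`; but an `l`-divisible power strictly lowers a nontrivial order. -/

namespace SpecialLinearGroup

/-! ### Free subgroups of `SL(2, ℤ)` by ping-pong -/

open Matrix

/-- The action of `SL(2, ℤ)` on the nonzero vectors of `ℤ²`. -/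
instance nonzeroVectorAction :
    MulAction (SpecialLinearGroup (Fin 2) ℤ) {v : Fin 2 → ℤ // v ≠ 0} where
  smul g v := ⟨(g : Matrix (Fin 2) (Fin 2) ℤ) *ᵥ v.1, fun h => v.2 <| by
    have h' := (mulVec_mulVec v.1 g.1.adjugate g.1).symm.trans
      ((congrArg (g.1.adjugate *ᵥ ·) h).trans (mulVec_zero _))
    rwa [adjugate_mul, g.2, one_smul, one_mulVec] at h'⟩
  one_smul v := Subtype.ext (one_mulVec v.1)
  mul_smul g h v := Subtype.ext (mulVec_mulVec v.1 _ _).symm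

/-- The transvections `!![1, m; 0, 1]` and `!![1, 0; m, 1]`. -/
def transvectionPair (m : ℤ) : Fin 2 → SpecialLinearGroup (Fin 2) ℤ :=
  ![⟨!![1, m; 0, 1], by simp [det_fin_two]⟩, ⟨!![1, 0; m, 1], by simp [det_fin_two]⟩]

theorem transvectionPair_zero_smul (m : ℤ) (v : {v : Fin 2 → ℤ // v ≠ 0}) :
    (transvectionPair m 0 • v).1 = ![v.1 0 + m * v.1 1, v.1 1] := by
  change !![1, m; 0, 1] *ᵥ v.1 = _
  ext i
  fin_cases i <;> simp [mulVec, dotProduct, Fin.sum_univ_two]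

theorem transvectionPair_one_smul (m : ℤ) (v : {v : Fin 2 → ℤ // v ≠ 0}) :
    (transvectionPair m 1 • v).1 = ![v.1 0, m * v.1 0 + v.1 1] := by
  change !![1, 0; m, 1] *ᵥ v.1 = _
  ext i
  fin_cases i <;> simp [mulVec, dotProduct, Fin.sum_univ_two]

theorem transvectionPair_inv (m : ℤ) (i : Fin 2) :
    (transvectionPair m)⁻¹ i = transvectionPair (-m) i := by
  refine inv_eq_of_mul_eq_one_right (Subtype.ext ?_)
  fin_cases i
  · change !![1, m; 0, 1] * !![1, -m; 0, 1] = (1 : Matrix (Fin 2) (Fin 2) ℤ)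
    simp [one_fin_two]
  · change !![1, 0; m, 1] * !![1, 0; -m, 1] = (1 : Matrix (Fin 2) (Fin 2) ℤ)
    simp [one_fin_two]

/-- Ping-pong on slopes `t = x / y`. The sets `X 0`, `Y 0`, `X 1`, `Y 1` are `[1, ∞]`, `(-∞, -1)`,
`[0, 1)`, `[-1, 0)`; the generators act by `t ↦ t + m` and `1/t ↦ 1/t + m`. Half-open arcs keep the
sets disjoint while admitting `m = 2`. -/
theorem lift_transvectionPair_injective {m : ℤ} (hm : 2 ≤ m) :
    Function.Injective (FreeGroup.lift (transvectionPair m)) := by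
  let X : Fin 2 → Set {v : Fin 2 → ℤ // v ≠ 0} :=
    ![{v | 0 ≤ v.1 1 * (v.1 0 - v.1 1)}, {v | 0 < v.1 0 * (v.1 1 - v.1 0) ∨ v.1 0 = 0}]
  let Y : Fin 2 → Set {v : Fin 2 → ℤ // v ≠ 0} :=
    ![{v | v.1 1 * (v.1 0 + v.1 1) < 0}, {v | v.1 0 * (v.1 1 + v.1 0) ≤ 0 ∧ v.1 0 ≠ 0}]
  have hne : ∀ v : {v : Fin 2 → ℤ // v ≠ 0}, v.1 0 = 0 → v.1 1 ≠ 0 := by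
    intro v h0 h1
    exact v.2 (by ext i; fin_cases i <;> simp [h0, h1])
  have hX01 : Disjoint (X 0) (X 1) := by
    rw [Set.disjoint_left]
    intro v h0 h1
    simp only [X, cons_val_zero, cons_val_one, Set.mem_ofPred_eq] at h0 h1
    rcases h1 with h1 | h1
    · nlinarith [sq_nonneg (v.1 0 - v.1 1)]
    · rw [h1] at h0
      have := sq_pos_of_ne_zero (hne v h1)
      nlinarith
  have hY01 : Disjoint (Y 0) (Y 1) := by
    rw [Set.disjoint_left]
    intro v h0 h1
    simp only [Y, cons_val_zero, cons_val_one, Set.mem_ofPred_eq] at h0 h1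
    nlinarith [sq_nonneg (v.1 0 + v.1 1)]
  refine FreeGroup.injective_lift_of_ping_pong (transvectionPair m) X Y ?_ ?_ ?_ ?_ ?_ ?_
  · intro i
    fin_cases i
    · exact ⟨⟨![1, 0], fun h => by simpa using congrFun h 0⟩, by simp [X]⟩
    · exact ⟨⟨![0, 1], fun h => by simpa using congrFun h 1⟩, by simp [X]⟩
  · intro i j hij
    fin_cases i <;> fin_cases j <;> first | exact absurd rfl hij | exact hX01 | exact hX01.symm
  · intro i j hij
    fin_cases i <;> fin_cases j <;> first | exact absurd rfl hij | exact hY01 | exact hY01.symm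
  · intro i j
    rw [Set.disjoint_left]
    intro v hx hy
    fin_cases i <;> fin_cases j <;>
      simp only [X, Y, Fin.zero_eta, Fin.mk_one, cons_val_zero, cons_val_one,
        Set.mem_ofPred_eq] at hx hy
    · nlinarith [sq_nonneg (v.1 1)]
    · have := sq_pos_of_ne_zero hy.2
      nlinarith [sq_nonneg (v.1 1)]
    · rcases hx with hx | hx
      · nlinarith [sq_nonneg (v.1 0), sq_nonneg (v.1 1)]
      · rw [hx] at hy
        nlinarith [sq_nonneg (v.1 1)]
    · rcases hx with hx | hx
      · nlinarith [sq_nonneg (v.1 0)]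
      · exact hy.2 hx
  · rintro i _ ⟨v, hv, rfl⟩
    fin_cases i <;>
      simp only [X, Y, Fin.zero_eta, Fin.mk_one, cons_val_zero, cons_val_one, Set.mem_compl_iff,
        Set.mem_ofPred_eq, transvectionPair_zero_smul, transvectionPair_one_smul, not_lt, not_and,
        not_not] at hv ⊢
    · nlinarith [mul_nonneg (sub_nonneg.2 hm) (sq_nonneg (v.1 1))]
    · by_cases h0 : v.1 0 = 0
      · exact Or.inr h0
      · have : 0 < v.1 0 * (v.1 1 + v.1 0) := by
          by_contra! h
          exact h0 (hv h)
        left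
        nlinarith [mul_nonneg (sub_nonneg.2 hm) (sq_nonneg (v.1 0))]
  · rintro i _ ⟨v, hv, rfl⟩
    rw [transvectionPair_inv]
    fin_cases i <;>
      simp only [X, Y, Fin.zero_eta, Fin.mk_one, cons_val_zero, cons_val_one, Set.mem_compl_iff,
        Set.mem_ofPred_eq, transvectionPair_zero_smul, transvectionPair_one_smul, not_le, not_or,
        not_lt] at hv ⊢
    · nlinarith [mul_nonneg (sub_nonneg.2 hm) (sq_nonneg (v.1 1))]
    · refine ⟨?_, hv.2⟩
      nlinarith [mul_nonneg (sub_nonneg.2 hm) (sq_nonneg (v.1 0))]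

end SpecialLinearGroup

/-! ### Residual finiteness through `l`-groups -/

/-- A matrix congruent to `1` modulo `l` has `l ^ k`-th power congruent to `1` modulo
`l ^ (k + 1)`. -/
theorem one_add_natCast_mul_pow_eq {R : Type*} [Ring R] (l k : ℕ) (B : R) :
    ∃ C : R, (1 + (l : R) * B) ^ l ^ k = 1 + (l : R) ^ (k + 1) * C := by
  -- `R` need not be commutative, so the divisibility is proved in `ℤ[X]` and evaluated at `B`.
  obtain ⟨c, hc⟩ := dvd_sub_pow_of_dvd_sub (R := Polynomial ℤ) (p := l)
    (a := 1 + (l : Polynomial ℤ) * Polynomial.X) (b := 1) (by simp) k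
  refine ⟨Polynomial.aeval B c, ?_⟩
  have := congrArg (Polynomial.aeval B) hc
  simp only [one_pow, map_sub, map_pow, map_add, map_one, map_mul, map_natCast,
    Polynomial.aeval_X] at this
  rw [← this]
  abel

namespace FreeGroupAB

/-- The free group of rank two is residually a finite `l`-group. -/
theorem exists_isPGroup_apply_ne_one (l : ℕ) [hl : Fact l.Prime] {w : FreeGroupAB} (hw : w ≠ 1) :
    ∃ (Q : Type) (_ : Group Q) (_ : Finite Q) (_ : IsPGroup l Q) (θ : FreeGroupAB →* Q),
      θ w ≠ 1 := by
  let ρ := FreeGroup.lift (SpecialLinearGroup.transvectionPair l)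
  have hρw : ρ w ≠ 1 := fun h => hw <|
    SpecialLinearGroup.lift_transvectionPair_injective (m := l)
      (by exact_mod_cast hl.out.two_le) (h.trans (map_one _).symm)
  -- A nonzero integer entry of `ρ w - 1` cannot be divisible by every `l ^ n`.
  obtain ⟨n, hn⟩ : ∃ n : ℕ,
      Matrix.SpecialLinearGroup.map (Int.castRingHom (ZMod (l ^ n))) (ρ w) ≠ 1 := by
    by_contra! h
    refine hρw (Matrix.SpecialLinearGroup.ext _ _ fun i j => ?_)
    have hdvd (n : ℕ) : ((l ^ n : ℕ) : ℤ) ∣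
        ρ w i j - (1 : Matrix.SpecialLinearGroup (Fin 2) ℤ) i j := by
      have hij := congrArg (fun A => A i j) (h n)
      rw [← ZMod.intCast_zmod_eq_zero_iff_dvd, Int.cast_sub, sub_eq_zero]
      refine hij.trans ?_
      by_cases hij : i = j <;> simp [hij]
    obtain ⟨N, hN⟩ := pow_unbounded_of_one_lt
      (ρ w i j - (1 : Matrix.SpecialLinearGroup (Fin 2) ℤ) i j).natAbs hl.out.one_lt
    exact sub_eq_zero.1 (Int.eq_zero_of_dvd_of_natAbs_lt_natAbs (hdvd N) (by simpa using hN))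
  have hmod (g : FreeGroupAB) : ∃ B : Matrix (Fin 2) (Fin 2) ℤ, 
      (ρ g).1 = 1 + (l : Matrix (Fin 2) (Fin 2) ℤ) * B := by
    have h1 : (Matrix.SpecialLinearGroup.map (Int.castRingHom (ZMod l))).comp ρ = 1 := by
      ext i j k
      rw [MonoidHom.comp_apply, FreeGroup.lift_apply_of]
      fin_cases i
      · change ((!![1, (l : ℤ); 0, 1] j k : ℤ) : ZMod l) = (1 : Matrix (Fin 2) (Fin 2) (ZMod l)) j k
        fin_cases j <;> fin_cases k <;> simp
      · change ((!![1, 0; (l : ℤ), 1] j k : ℤ) : ZMod l) = (1 : Matrix (Fin 2) (Fin 2) (ZMod l)) j k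
        fin_cases j <;> fin_cases k <;> simp
    have hdvd (i j : Fin 2) : (l : ℤ) ∣ ρ g i j - (1 : Matrix (Fin 2) (Fin 2) ℤ) i j := by
      rw [← ZMod.intCast_zmod_eq_zero_iff_dvd, Int.cast_sub, sub_eq_zero]
      refine (congrArg (fun A => A i j) (DFunLike.congr_fun h1 g)).trans ?_
      by_cases hij : i = j <;> simp [Matrix.one_apply, hij]
    choose B hB using hdvd
    refine ⟨Matrix.of B, Matrix.ext fun i j => ?_⟩
    rw [← nsmul_eq_mul, Matrix.add_apply, Matrix.smul_apply, nsmul_eq_mul]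
    exact eq_add_of_sub_eq' (hB i j)
  let θ := (Matrix.SpecialLinearGroup.map (n := Fin 2) (Int.castRingHom (ZMod (l ^ n)))).comp ρ
  have : NeZero (l ^ n) := ⟨pow_ne_zero _ hl.out.ne_zero⟩
  have : Finite (Matrix.SpecialLinearGroup (Fin 2) (ZMod (l ^ n))) :=
    Subtype.finite
  -- The range consists of matrices congruent to `1` modulo `l`, so it is an `l`-group, unlike the
  -- whole of `SL(2, ℤ/lⁿ)` in general.
  refine ⟨θ.range, inferInstance, inferInstance, ?_, θ.rangeRestrict, ?_⟩
  · rintro ⟨_, g, rfl⟩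
    refine ⟨n, Subtype.ext ?_⟩
    obtain ⟨B, hB⟩ := hmod g
    obtain ⟨C, hC⟩ := one_add_natCast_mul_pow_eq l n B
    have hpow : (ρ (g ^ l ^ n)).1 = 1 + (l : Matrix (Fin 2) (Fin 2) ℤ) ^ (n + 1) * C := by
      rw [← hC, ← hB, map_pow]
      exact Matrix.SpecialLinearGroup.coe_pow _ _
    change θ g ^ l ^ n = 1
    rw [← map_pow]
    refine Matrix.SpecialLinearGroup.ext _ _ fun i j => ?_
    have hij := congrArg (fun A => ((A i j : ℤ) : ZMod (l ^ n))) hpow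
    refine hij.trans ?_
    have hl0 : ((l : ZMod (l ^ n)) ^ (n + 1)) = 0 := by
      rw [pow_succ, ← Nat.cast_pow, ZMod.natCast_self, zero_mul]
    rw [← Nat.cast_pow, ← nsmul_eq_mul, Matrix.add_apply, Matrix.smul_apply, nsmul_eq_mul]
    push_cast
    rw [hl0, zero_mul, add_zero]
    by_cases hij : i = j <;> simp [Matrix.one_apply, hij]
  · intro h
    exact hn (congrArg Subtype.val h)

/-! ### Precomposition with `ψ` -/

/-- A homomorphism to a commutative group that kills `ψ` is trivial if `ψ` has unimodular
associated matrix. -/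
theorem hom_eq_one_of_comp_eq_one {A : Type*} [CommGroup A] {ψ : FreeGroupAB →* FreeGroupAB}
    (hdet : (associatedMatrix ψ).det = 1 ∨ (associatedMatrix ψ).det = -1)
    (φ : FreeGroupAB →* A) (hφ : φ.comp ψ = 1) : φ = 1 := by
  have key : φ = (zpowersHom A (φ (FreeGroup.of 0))).comp
        (FreeGroup.lift fun j : Fin 2 => Multiplicative.ofAdd (if j = 0 then (1 : ℤ) else 0)) *
      (zpowersHom A (φ (FreeGroup.of 1))).comp
        (FreeGroup.lift fun j : Fin 2 => Multiplicative.ofAdd (if j = 1 then (1 : ℤ) else 0)) := by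
    ext i
    fin_cases i <;> simp
  have hrow (i : Fin 2) : φ (FreeGroup.of 0) ^ associatedMatrix ψ i 0 *
      φ (FreeGroup.of 1) ^ associatedMatrix ψ i 1 = 1 :=
    (DFunLike.congr_fun key (ψ (FreeGroup.of i))).symm.trans
      (DFunLike.congr_fun hφ (FreeGroup.of i))
  generalize associatedMatrix ψ = M at hdet hrow
  -- Cramer's rule in the exponents eliminates the other generator.
  have h0 : φ (FreeGroup.of 0) ^ M.det = 1 := by
    have e : φ (FreeGroup.of 0) ^ M.det =
        (φ (FreeGroup.of 0) ^ M 0 0 * φ (FreeGroup.of 1) ^ M 0 1) ^ M 1 1 *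
          ((φ (FreeGroup.of 0) ^ M 1 0 * φ (FreeGroup.of 1) ^ M 1 1) ^ M 0 1)⁻¹ := by
      rw [Matrix.det_fin_two, mul_zpow, mul_zpow, ← zpow_mul, ← zpow_mul, ← zpow_mul, ← zpow_mul,
        zpow_sub, mul_comm (M 0 1) (M 1 0), mul_comm (M 1 1) (M 0 1)]
      group
    rw [e, hrow, hrow, one_zpow, one_zpow, inv_one, one_mul]
  have h1 : φ (FreeGroup.of 1) ^ M.det = 1 := by
    have e : φ (FreeGroup.of 1) ^ M.det =
        (φ (FreeGroup.of 0) ^ M 1 0 * φ (FreeGroup.of 1) ^ M 1 1) ^ M 0 0 *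
          ((φ (FreeGroup.of 0) ^ M 0 0 * φ (FreeGroup.of 1) ^ M 0 1) ^ M 1 0)⁻¹ := by
      rw [Matrix.det_fin_two, mul_zpow, mul_zpow, ← zpow_mul, ← zpow_mul, ← zpow_mul, ← zpow_mul,
        zpow_sub, mul_comm (M 1 1) (M 0 0), mul_comm (M 1 0) (M 0 0), mul_inv, mul_mul_mul_comm,
        mul_inv_cancel, one_mul]
    rw [e, hrow, hrow, one_zpow, one_zpow, inv_one, one_mul]
  ext i
  rcases hdet with hd | hd <;> rw [hd] at h0 h1 <;> fin_cases i <;>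
    first | simpa using h0 | simpa using h1

/-- Precomposition with `ψ` preserves surjections onto finite nilpotent groups: otherwise the image
lies in a maximal subgroup, which is normal with abelian quotient. -/
theorem surjective_comp_of_surjective {Q : Type*} [Group Q] [Group.IsNilpotent Q] [Finite Q]
    {ψ : FreeGroupAB →* FreeGroupAB}
    (hdet : (associatedMatrix ψ).det = 1 ∨ (associatedMatrix ψ).det = -1)
    (θ : FreeGroupAB →* Q) (hθ : Function.Surjective θ) :
    Function.Surjective (θ.comp ψ) := by
  rw [← MonoidHom.range_eq_top]
  by_contra hne
  obtain ⟨K, hK, hle⟩ := (eq_top_or_exists_le_coatom (θ.comp ψ).range).resolve_left hne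
  have hnorm : K.Normal := Subgroup.NormalizerCondition.normal_of_coatom K
    Group.normalizerCondition_of_isNilpotent hK
  have : IsSimpleGroup (Q ⧸ K) :=
    { exists_pair_ne := (QuotientGroup.nontrivial_iff.2 hK.1).exists_pair_ne
      eq_bot_or_eq_top_of_normal := fun H _ => by
        have hKH : K ≤ H.comap (QuotientGroup.mk' K) := fun x hx => by
          have h1 : QuotientGroup.mk' K x = 1 := (QuotientGroup.eq_one_iff x).2 hx
          rw [Subgroup.mem_comap, h1]
          exact H.one_mem
        rw [← Subgroup.map_comap_eq_self_of_surjective (QuotientGroup.mk'_surjective K) H]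
        rcases hK.le_iff.1 hKH with h | h
        · right
          rw [h, ← MonoidHom.range_eq_map, QuotientGroup.range_mk']
        · left
          rw [h, QuotientGroup.map_mk'_self] }
  let : CommGroup (Q ⧸ K) := { (inferInstance : Group (Q ⧸ K)) with
    mul_comm := IsSimpleGroup.comm_iff_isSolvable.2 inferInstance }
  have h := hom_eq_one_of_comp_eq_one hdet ((QuotientGroup.mk' K).comp θ) (by
    ext i
    exact (QuotientGroup.eq_one_iff _).2 (hle ⟨_, rfl⟩))
  refine hK.1 (eq_top_iff.2 fun x _ => ?_)
  obtain ⟨g, rfl⟩ := hθ x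
  exact (QuotientGroup.eq_one_iff _).1 (DFunLike.congr_fun h g)

/-- By finiteness injectivity suffices. If `θ₁ ∘ ψ = θ₂ ∘ ψ`, then `(θ₁, θ₂) ∘ ψ` lands in the
diagonal, yet it still fills the whole image of `(θ₁, θ₂)`, an `l`-group; hence `θ₁ = θ₂`. -/
theorem comp_right_bijective {Q : Type*} [Group Q] [Finite Q] (l : ℕ) [Fact l.Prime]
    (hQ : IsPGroup l Q) {ψ : FreeGroupAB →* FreeGroupAB}
    (hdet : (associatedMatrix ψ).det = 1 ∨ (associatedMatrix ψ).det = -1) :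
    Function.Bijective fun θ : FreeGroupAB →* Q => θ.comp ψ := by
  have : Finite (FreeGroupAB →* Q) := Finite.of_equiv _ FreeGroup.lift
  refine Function.Injective.bijective_of_finite fun θ₁ θ₂ h => ?_
  have hP : IsPGroup l (θ₁.prod θ₂).range := by
    rintro ⟨⟨x, y⟩, hxy⟩
    obtain ⟨j, hj⟩ := hQ x
    obtain ⟨k, hk⟩ := hQ y
    refine ⟨j + k, Subtype.ext (Prod.ext ?_ ?_)⟩
    · change x ^ l ^ (j + k) = 1
      rw [pow_add, pow_mul, hj, one_pow]
    · change y ^ l ^ (j + k) = 1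
      rw [pow_add, mul_comm, pow_mul, hk, one_pow]
  have : Group.IsNilpotent (θ₁.prod θ₂).range := hP.isNilpotent
  have hs := surjective_comp_of_surjective hdet _ (θ₁.prod θ₂).rangeRestrict_surjective
  ext i
  obtain ⟨g, hg⟩ := hs ((θ₁.prod θ₂).rangeRestrict (FreeGroup.of i))
  have hg' := congrArg Subtype.val hg
  have h1 := congrArg Prod.fst hg'
  have h2 := congrArg Prod.snd hg'
  exact (h1.symm.trans (DFunLike.congr_fun h g)).trans h2

theorem exists_eq_comp_iterate {Q : Type*} [Group Q] [Finite Q] (l : ℕ) [Fact l.Prime]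
    (hQ : IsPGroup l Q) {ψ : FreeGroupAB →* FreeGroupAB}
    (hdet : (associatedMatrix ψ).det = 1 ∨ (associatedMatrix ψ).det = -1) (n : ℕ)
    (θ : FreeGroupAB →* Q) : ∃ θ' : FreeGroupAB →* Q, ∀ g, θ g = θ' (ψ^[n] g) := by
  induction n generalizing θ with
  | zero => exact ⟨θ, fun _ => rfl⟩
  | succ n ih =>
    obtain ⟨θ₁, h₁⟩ := (comp_right_bijective l hQ hdet).2 θ
    obtain ⟨θ', h'⟩ := ih θ₁
    refine ⟨θ', fun g => ?_⟩
    rw [Function.iterate_succ_apply, ← h', ← h₁, MonoidHom.comp_apply]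

/-! ### Comparing orders of images -/

theorem orderOf_zpow_lt {Q : Type*} [Group Q] [Finite Q] {l : ℕ} [hl : Fact l.Prime]
    (hQ : IsPGroup l Q) {q : ℤ} (hq : (l : ℤ) ∣ q) {x : Q} (hx : x ≠ 1) :
    orderOf (x ^ q) < orderOf x := by
  obtain ⟨k, hk⟩ := IsPGroup.iff_orderOf.1 hQ x
  obtain ⟨c, rfl⟩ := hq
  have hk0 : k ≠ 0 := by
    rintro rfl
    exact hx (orderOf_eq_one_iff.1 (by simpa using hk))
  obtain ⟨j, rfl⟩ := Nat.exists_eq_succ_of_ne_zero hk0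
  have h1 : (x ^ ((l : ℤ) * c)) ^ l ^ j = 1 := by
    have : (x ^ ((l : ℤ) * c)) ^ l ^ j = (x ^ (l ^ (j + 1))) ^ c := by
      rw [← zpow_natCast, ← zpow_natCast, ← zpow_mul, ← zpow_mul]
      congr 1
      push_cast
      ring
    rw [this, ← hk, pow_orderOf_eq_one, one_zpow]
  rw [hk]
  exact (orderOf_le_of_pow_eq_one (pow_pos hl.out.pos _) h1).trans_lt
    (Nat.pow_lt_pow_right hl.out.one_lt (Nat.lt_succ_self j))

theorem orderOf_eq_of_isConj {Q : Type*} [Group Q] {x y : Q} (h : IsConj x y) :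
    orderOf x = orderOf y := by
  obtain ⟨c, rfl⟩ := isConj_iff.1 h
  exact ((MulAut.conj c).orderOf_eq x).symm

/-- Among the homomorphisms to a finite `l`-group, one that maximizes the order of the image of `w`
rules out that `ψ^[n] w` and `w` are related by an `l`-divisible power. -/
theorem not_isConj_iterate_zpow (l : ℕ) [Fact l.Prime] {ψ : FreeGroupAB →* FreeGroupAB}
    (hdet : (associatedMatrix ψ).det = 1 ∨ (associatedMatrix ψ).det = -1) {q : ℤ}
    (hq : (l : ℤ) ∣ q) {w : FreeGroupAB} (hw : w ≠ 1) (n : ℕ) :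
    ¬ IsConj (ψ^[n] w) (w ^ q) ∧ ¬ IsConj w (ψ^[n] w ^ q) := by
  obtain ⟨Q, _, _, hQ, θ₀, hθ₀⟩ := exists_isPGroup_apply_ne_one l hw
  have : Finite (FreeGroupAB →* Q) := Finite.of_equiv _ FreeGroup.lift
  obtain ⟨θ, hθ⟩ := Finite.exists_max fun θ : FreeGroupAB →* Q => orderOf (θ w)
  have hθw : θ w ≠ 1 := by
    intro h
    have h₀ := hθ θ₀
    rw [h, orderOf_one] at h₀
    exact hθ₀ (orderOf_eq_one_iff.1 (le_antisymm h₀ (orderOf_pos _)))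
  constructor
  · intro h
    -- With `θ = θ' ∘ ψ^[n]`, `θ w` has the order of `θ' w ^ q`, so `θ' w` beats the maximum.
    obtain ⟨θ', h'⟩ := exists_eq_comp_iterate l hQ hdet n θ
    have e := orderOf_eq_of_isConj (θ'.map_isConj h)
    rw [← h', map_zpow] at e
    have hne : θ' w ≠ 1 := by
      intro h1
      rw [h1, one_zpow, orderOf_one] at e
      exact hθw (orderOf_eq_one_iff.1 e)
    exact absurd (hθ θ') (not_le.2 (e ▸ orderOf_zpow_lt hQ hq hne))
  · intro h
    have e := orderOf_eq_of_isConj (θ.map_isConj h)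
    rw [map_zpow] at e
    have hne : θ (ψ^[n] w) ≠ 1 := by
      intro h1
      rw [h1, one_zpow, orderOf_one] at e
      exact hθw (orderOf_eq_one_iff.1 e)
    -- Here the competitor is `θ ∘ ψ^[n]`, bounded by maximality of `θ`.
    have hle : orderOf (θ (ψ^[n] w)) ≤ orderOf (θ w) := by
      have hcoe := congrFun (Monoid.End.coe_pow FreeGroupAB ψ n) w
      exact (congrArg (fun x => orderOf (θ x)) hcoe).symm.trans_le
        (hθ (θ.comp (HPow.hPow (α := Monoid.End FreeGroupAB) ψ n)))
    exact absurd hle (not_le.2 (e ▸ orderOf_zpow_lt hQ hq hne))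

end FreeGroupAB

theorem mainTheorem7 (ψ : FreeGroupAB →* FreeGroupAB)
    (hinj : Function.Injective ψ) (hsurj : ¬ Function.Surjective ψ)
    (hdet : (FreeGroupAB.associatedMatrix ψ).det = 1 ∨ (FreeGroupAB.associatedMatrix ψ).det = -1)
    (α : ConjClasses FreeGroupAB) (hα : FreeGroupAB.IsMaximalOuterFixedPoint ψ α)
    (hα_ne : α ≠ ConjClasses.mk 1)
    (w : FreeGroupAB) (hw : w ≠ 1) (p q : ℤ) (hp : p ≠ 0) (hq : q ≠ 0)
    (h : ∃ u : FreeGroupAB, FreeGroupAB.ZPowRel ψ p w u ∧ IsConj u (w ^ q)) :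
    q = 1 ∨ q = -1 := by
  by_contra hne
  obtain ⟨l, hl, hlq⟩ := Nat.exists_prime_and_dvd (n := q.natAbs)
    fun h1 => hne (Int.natAbs_eq_iff.1 h1)
  have : Fact l.Prime := ⟨hl⟩
  have hlq' : (l : ℤ) ∣ q := Int.natCast_dvd.2 hlq
  obtain ⟨u, hu, hconj⟩ := h
  cases p with
  | ofNat n =>
    change ψ^[n] w = u at hu
    subst hu
    exact (FreeGroupAB.not_isConj_iterate_zpow l hdet hlq' hw n).1 hconj
  | negSucc n =>
    change ψ^[n + 1] u = w at hu
    have hu1 : u ≠ 1 := by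
      rintro rfl
      exact hw (hu.symm.trans (iterate_map_one ψ _))
    -- The second half applies with base element `u`, since `w = ψ^[n + 1] u`.
    subst hu
    exact (FreeGroupAB.not_isConj_iterate_zpow l hdet hlq' hu1 (n + 1)).2 hconj
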